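/- Let $q=2^h$ with $h\ge 3$, let $\alpha$ be a primitive element of $\mathbb F_q$ (a generator of $\mathbb F_q^*$), put $\alpha_i=\alpha^i$ for $1\le i\le q-1$, and let $3\le k\le q-4$. Let $\mathcal C_k\subseteq\mathbb F_q^{q-1}$ be the linear code generated by the rows of the $k\times(q-1)$ matrix whose rows are $(\alpha_1^{e},\alpha_2^{e},\dots,\alpha_{q-1}^{e})$ for $e=0,1,\dots,k-2,k$ (the exponent $k-1$ is skipped), and let $\mathcal C_k^{\perp}$ be its Euclidean dual. Definitions. Let $\mathcal C$ be an $[n,K,d]_q$ linear code, i.e. a $K$-dimensional subspace of $\mathbb F_q^n$ with minimum Hamming distance $d$. A recovering set of the coordinate $i$ is a set $R\subseteq\{1,\dots,n\}\setminus\{i\}$ for which there is a function $f:\mathbb F_q^{R}\to\mathbb F_q$ with $c_i=f(c_R)$ for all $c\in\mathcal C$, where $c_R$ is the projection of $c$ to the positions in $R$. The code $\mathcal C$ is an $(n,K,d,q;r)$-locally recoverable code if every coordinate has a recovering set of size $r$, and $r$ is the minimum size of a recovering set (no recovering set of any coordinate has fewer than $r$ elements). Let $k^{q}_{\mathrm{opt}}(m,d)$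 be the largest dimension of a linear code over $\mathbb F_q$ of length $m$ and minimum distance at least $d$ (the zero code is allowed; the value is $0$ if $m\le 0$). An $(n,K,d,q;r)$-locally recoverable code is $k$-optimal if it attains the Cadambe–Mazumdar bound, $$K=\min_{t\in\mathbb Z^{+}}\bigl\{rt+k^{q}_{\mathrm{opt}}(n-t(r+1),d)\bigr\},$$ and $d$-optimal if it attains the Singleton-like bound, $$d=n-K-\left\lceil \frac{K}{r}\right\rceil+2 .$$ Theorem. 1. $\mathcal C_k$ is a $(q-1,\,k,\,q-k-1,\,q;\,k-1)$-locally recoverable code that is both $k$-optimal and $d$-optimal. 2. $\mathcal C_k^{\perp}$ is a $(q-1,\,q-k-1,\,k,\,q;\,q-k-2)$-locally recoverable code that is both $k$-optimal and $d$-optimal. -/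

import Mathlib

namespace LRC

/-- `C` is an `[n, k, d]` linear code over `F`: a `k`-dimensional subspace of `F ^ n` whose minimum
distance, i.e. the least Hamming distance between two distinct codewords, is `d`. -/
def IsLinearCode {F : Type*} [Field F] [DecidableEq F] {n : ℕ}
    (C : Submodule F (Fin n → F)) (k d : ℕ) : Prop :=
  Module.finrank F C = k ∧
    IsLeast {w : ℕ | ∃ x ∈ C, ∃ y ∈ C, x ≠ y ∧ hammingDist x y = w} d

/-- The Euclidean dual code: all `y` with `∑ i, x i * y i = 0` for every codeword `x`. -/
def dualCode {F : Type*} [Field F] {n : ℕ} (C : Submodule F (Fin n → F)) :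
    Submodule F (Fin n → F) where
  carrier := {y | ∀ x ∈ C, ∑ i, x i * y i = 0}
  add_mem' := by
    intro a b ha hb x hx
    simp only [Pi.add_apply, mul_add, Finset.sum_add_distrib]
    rw [ha x hx, hb x hx, add_zero]
  zero_mem' := by
    intro x _
    simp
  smul_mem' := by
    intro c a ha x hx
    have h : ∀ i, x i * (c • a) i = c * (x i * a i) := by
      intro i
      simp only [Pi.smul_apply, smul_eq_mul]
      ring
    simp only [h]
    rw [← Finset.mul_sum, ha x hx, mul_zero]

/-- The `k × (q - 1)` matrix whose columns are indexed by the powers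
`α ^ 1, α ^ 2, …, α ^ (q - 1)` and whose rows carry the exponents `0, 1, …, k - 2, k`
(the exponent `k - 1` is skipped). Column `j : Fin (q - 1)` belongs to `α ^ (j + 1)`. -/
def genMatrix {F : Type*} [Field F] (α : F) (q k : ℕ) : Matrix (Fin k) (Fin (q - 1)) F :=
  Matrix.of fun i j => (α ^ ((j : ℕ) + 1)) ^ (if (i : ℕ) + 1 < k then (i : ℕ) else k)

/-- The code generated by the rows of `genMatrix α q k`. -/
def codeC {F : Type*} [Field F] (α : F) (q k : ℕ) : Submodule F (Fin (q - 1) → F) :=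
  Submodule.span F (Set.range (genMatrix α q k).row)

/-- `R` is a recovering set of the coordinate `i` of `C`: `i ∉ R` and some function of the entries
at the positions in `R` returns the `i`-th entry of every codeword. -/
def IsRecoveringSet {F : Type*} [Field F] {n : ℕ} (C : Submodule F (Fin n → F))
    (i : Fin n) (R : Finset (Fin n)) : Prop :=
  i ∉ R ∧ ∃ f : (R → F) → F, ∀ c ∈ C, c i = f (fun j => c j)

/-- `C` is an `(n, k, d, q; r)`-locally recoverable code (with `q` the cardinality of `F`): an
`[n, k, d]` linear code such that every coordinate has a recovering set of size `r`, where `r` is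
the minimum size of a recovering set. -/
structure IsLRC {F : Type*} [Field F] [DecidableEq F] {n : ℕ}
    (C : Submodule F (Fin n → F)) (k d r : ℕ) : Prop where
  isLinearCode : IsLinearCode C k d
  exists_recoveringSet : ∀ i : Fin n, ∃ R : Finset (Fin n), R.card = r ∧ IsRecoveringSet C i R
  le_card : ∀ (i : Fin n) (R : Finset (Fin n)), IsRecoveringSet C i R → r ≤ R.card

/-- The set of dimensions of the linear codes of length `n` over `F` with minimum distance at
least `d` (the zero code has no two distinct codewords and always counts). -/
def codeDims (F : Type*) [Field F] [DecidableEq F] (n d : ℕ) : Set ℕ :=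
  {m | ∃ D : Submodule F (Fin n → F), Module.finrank F D = m ∧
    ∀ x ∈ D, ∀ y ∈ D, x ≠ y → d ≤ hammingDist x y}

/-- `k_opt (n, d)`: the largest dimension of a linear code of length `n` over `F` with minimum
distance at least `d`; it is `0` if only the zero code qualifies. -/
noncomputable def kOpt (F : Type*) [Field F] [DecidableEq F] (n d : ℕ) : ℕ :=
  sSup (codeDims F n d)

/-- The supremum in `kOpt` is a maximum. -/
theorem isGreatest_kOpt (F : Type*) [Field F] [DecidableEq F] (n d : ℕ) :
    IsGreatest (codeDims F n d) (kOpt F n d) := by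
  have hne : (codeDims F n d).Nonempty := by
    refine ⟨0, ⊥, finrank_bot F _, ?_⟩
    intro x hx y hy hxy
    rw [Submodule.mem_bot] at hx hy
    exact absurd (hx.trans hy.symm) hxy
  have hbdd : BddAbove (codeDims F n d) := by
    refine ⟨n, ?_⟩
    rintro m ⟨D, rfl, -⟩
    simpa using Submodule.finrank_le D
  exact ⟨Nat.sSup_mem hne hbdd, fun m hm => le_csSup hbdd hm⟩

/-- A locally recoverable code is `k`-optimal if it attains the Cadambe-Mazumdar bound:
`k = min_{t ≥ 1} (r * t + k_opt (n - t * (r + 1), d))`. A negative length `n - t * (r + 1)` is read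
as length `0`, so that `k_opt` is `0` there for every `d`. -/
def IsKOptimal {F : Type*} [Field F] [DecidableEq F] {n : ℕ}
    (C : Submodule F (Fin n → F)) (k d r : ℕ) : Prop :=
  IsLRC C k d r ∧
    IsLeast {b : ℕ | ∃ t : ℕ, 1 ≤ t ∧ b = r * t + kOpt F (n - t * (r + 1)) d} k

/-- A locally recoverable code is `d`-optimal if it attains the Singleton-like bound:
`d = n - k - ⌈k / r⌉ + 2`. -/
def IsDOptimal {F : Type*} [Field F] [DecidableEq F] {n : ℕ}
    (C : Submodule F (Fin n → F)) (k d r : ℕ) : Prop :=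
  IsLRC C k d r ∧ (d : ℤ) = (n : ℤ) - (k : ℤ) - ⌈(k : ℚ) / (r : ℚ)⌉ + 2

end LRC

open Polynomial

namespace LRC

variable {F : Type*} [Field F] {n : ℕ}

theorem isRecoveringSet_iff (C : Submodule F (Fin n → F)) (i : Fin n) (R : Finset (Fin n)) :
    IsRecoveringSet C i R ↔ i ∉ R ∧ ∀ c ∈ C, (∀ j ∈ R, c j = 0) → c i = 0 := by
  classical
  refine and_congr_right fun _ => ⟨?_, fun H => ?_⟩
  · rintro ⟨f, hf⟩ c hc h0
    have h1 := hf c hc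
    have h2 := hf 0 C.zero_mem
    have h3 : (fun j : R => c j) = fun j : R => (0 : Fin n → F) j := by
      funext j
      exact h0 j j.2
    rw [h1, h3, ← h2, Pi.zero_apply]
  · refine ⟨fun u => if h : ∃ c ∈ C, ∀ j : R, c j = u j then h.choose i else 0, fun c hc => ?_⟩
    have h : ∃ c' ∈ C, ∀ j : R, c' j = c j := ⟨c, hc, fun _ => rfl⟩
    simp only [dif_pos h]
    have hs := h.choose_spec
    have := H (c - h.choose) (C.sub_mem hc hs.1) fun j hj => by
      rw [Pi.sub_apply, hs.2 ⟨j, hj⟩, sub_self]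
    exact sub_eq_zero.mp this

/-- The exponents `0, 1, …, k - 2, k`. -/
def skipExponent (k i : ℕ) : ℕ := if i + 1 < k then i else k

/-- The code with generators `j ↦ v j * a j ^ e`, where `e` runs through `0, 1, …, k - 2, k`. -/
def skipCode (a v : Fin n → F) (k : ℕ) : Submodule F (Fin n → F) :=
  Submodule.span F (Set.range fun (i : Fin k) (j : Fin n) => v j * a j ^ skipExponent k i)

theorem skipExponent_le {k i : ℕ} : skipExponent k i ≤ k := by
  unfold skipExponent; split_ifs <;> omega

theorem skipExponent_ne {k i : ℕ} (hk : 1 ≤ k) : skipExponent k i ≠ k - 1 := by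
  unfold skipExponent; split_ifs <;> omega

theorem skipExponent_injective (k : ℕ) :
    Function.Injective fun i : Fin k => skipExponent k i := by
  intro i j hij
  have := i.2
  have := j.2
  simp only [skipExponent] at hij
  ext
  split_ifs at hij <;> omega

theorem exists_skipExponent_eq {k e : ℕ} (hk : 1 ≤ k) (he : e ≤ k) (hne : e ≠ k - 1) :
    ∃ i : Fin k, skipExponent k i = e := by
  rcases he.eq_or_lt with rfl | h
  · exact ⟨⟨e - 1, by omega⟩, by simp only [skipExponent]; split_ifs <;> omega⟩
  · exact ⟨⟨e, h⟩, by simp only [skipExponent]; split_ifs <;> omega⟩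

theorem mem_skipCode {a v : Fin n → F} {k : ℕ} (hk : 1 ≤ k) {c : Fin n → F} :
    c ∈ skipCode a v k ↔
      ∃ p : F[X], p.natDegree ≤ k ∧ p.coeff (k - 1) = 0 ∧ ∀ j, c j = v j * p.eval (a j) := by
  constructor
  · intro hc
    induction hc using Submodule.span_induction with
    | mem x hx =>
      obtain ⟨i, rfl⟩ := hx
      refine ⟨X ^ skipExponent k i, ?_, ?_, fun j => by simp⟩
      · rw [natDegree_X_pow]; exact skipExponent_le
      · rw [coeff_X_pow, if_neg (skipExponent_ne hk).symm]
    | zero => exact ⟨0, by simp, by simp, by simp⟩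
    | add x y _ _ hx hy =>
      obtain ⟨p, hp, hp', hpx⟩ := hx
      obtain ⟨r, hr, hr', hry⟩ := hy
      refine ⟨p + r, natDegree_add_le_of_degree_le hp hr, by simp [hp', hr'], fun j => ?_⟩
      rw [Pi.add_apply, hpx, hry, eval_add, mul_add]
    | smul s x _ hx =>
      obtain ⟨p, hp, hp', hpx⟩ := hx
      refine ⟨s • p, (natDegree_smul_le s p).trans hp, by simp [hp'], fun j => ?_⟩
      rw [Pi.smul_apply, hpx, eval_smul, smul_eq_mul, smul_eq_mul, mul_left_comm]
  · rintro ⟨p, hp, hp', hc⟩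
    have : c = ∑ e ∈ Finset.range (k + 1), p.coeff e • fun j => v j * a j ^ e := by
      funext j
      rw [hc, eval_eq_sum_range' (Nat.lt_succ_of_le hp), Finset.mul_sum, Finset.sum_apply]
      exact Finset.sum_congr rfl fun e _ => by
        rw [Pi.smul_apply, smul_eq_mul, mul_left_comm]
    rw [this]
    refine Submodule.sum_mem _ fun e he => ?_
    by_cases hne : e = k - 1
    · rw [hne, hp', zero_smul]; exact Submodule.zero_mem _
    · obtain ⟨i, hi⟩ := exists_skipExponent_eq hk (Nat.lt_succ_iff.mp (Finset.mem_range.mp he)) hne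
      exact Submodule.smul_mem _ _ (Submodule.subset_span ⟨i, by simp only [hi]⟩)

theorem eq_zero_of_eval_eq_zero_of_natDegree_lt {a : Fin n → F} (ha : Function.Injective a)
    {p : F[X]} {S : Finset (Fin n)} (hS : ∀ j ∈ S, p.eval (a j) = 0) (hp : p.natDegree < S.card) :
    p = 0 := by
  classical
  refine eq_zero_of_natDegree_lt_card_of_eval_eq_zero' p (S.image a) ?_ ?_
  · simpa using hS
  · rwa [Finset.card_image_of_injective _ ha]

theorem finrank_skipCode {a v : Fin n → F} {k : ℕ} (ha : Function.Injective a)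
    (hv : ∀ j, v j ≠ 0) (hkn : k < n) : Module.finrank F (skipCode a v k) = k := by
  unfold skipCode
  rw [finrank_span_eq_card, Fintype.card_fin]
  rw [Fintype.linearIndependent_iff]
  intro g hg i
  set p : F[X] := ∑ i : Fin k, C (g i) * X ^ skipExponent k i with hp
  have hdeg : p.natDegree ≤ k := natDegree_sum_le_of_forall_le _ _ fun i _ =>
    (natDegree_C_mul_X_pow_le _ _).trans skipExponent_le
  have h0 : p = 0 := by
    refine eq_zero_of_eval_eq_zero_of_natDegree_lt ha (S := Finset.univ) (fun j _ => ?_) ?_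
    · have := congrFun hg j
      rw [Finset.sum_apply] at this
      have h2 : v j * p.eval (a j) = 0 := by
        rw [hp, eval_finsetSum, Finset.mul_sum, ← this.trans (Pi.zero_apply j)]
        exact Finset.sum_congr rfl fun e _ => by
          simp only [eval_mul, eval_C, eval_pow, eval_X, Pi.smul_apply, smul_eq_mul]
          ring
      exact (mul_eq_zero.mp h2).resolve_left (hv j)
    · simpa using hdeg.trans_lt hkn
  have hc : p.coeff (skipExponent k i) = g i := by
    rw [hp, finsetSum_coeff, Finset.sum_eq_single i]
    · simp
    · intro b _ hb
      rw [coeff_C_mul_X_pow, if_neg]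
      exact fun h => hb (skipExponent_injective k h).symm
    · simp
  rw [← hc, h0, coeff_zero]

/-- The polynomial with simple roots `a j` for `j ∈ S`. -/
noncomputable def rootPoly (a : Fin n → F) (S : Finset (Fin n)) : F[X] := ∏ j ∈ S, (X - C (a j))

theorem natDegree_rootPoly (a : Fin n → F) (S : Finset (Fin n)) :
    (rootPoly a S).natDegree = S.card := by
  simp [rootPoly]

theorem eval_rootPoly_eq_zero_iff {a : Fin n → F} (ha : Function.Injective a)
    {S : Finset (Fin n)} {i : Fin n} : (rootPoly a S).eval (a i) = 0 ↔ i ∈ S := by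
  rw [rootPoly, eval_prod, Finset.prod_eq_zero_iff]
  simp only [eval_sub, eval_X, eval_C, sub_eq_zero]
  exact ⟨fun ⟨j, hj, h⟩ => ha h ▸ hj, fun h => ⟨i, h, rfl⟩⟩

theorem coeff_rootPoly_card_sub_one {a : Fin n → F} {S : Finset (Fin n)} (hS : 0 < S.card)
    (h0 : ∑ j ∈ S, a j = 0) : (rootPoly a S).coeff (S.card - 1) = 0 := by
  rw [rootPoly, prod_X_sub_C_coeff_card_pred S a hS, h0, neg_zero]

theorem coeff_rootPoly_card (a : Fin n → F) (S : Finset (Fin n)) :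
    (rootPoly a S).coeff S.card = 1 := by
  have h : (rootPoly a S).Monic := monic_prod_of_monic _ _ fun j _ => monic_X_sub_C _
  rw [← natDegree_rootPoly a S]
  exact h.coeff_natDegree

theorem eval_eq_zero_of_sum_eq_zero {a : Fin n → F} (ha : Function.Injective a) {p : F[X]} {k : ℕ}
    (hk : 2 ≤ k) (hp : p.natDegree ≤ k) (hp' : p.coeff (k - 1) = 0) {S : Finset (Fin n)}
    (hS : S.card = k) (h0 : ∑ j ∈ S, a j = 0) {i : Fin n} (hi : i ∈ S)
    (hv : ∀ j ∈ S.erase i, p.eval (a j) = 0) : p.eval (a i) = 0 := by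
  have hr : (p - C (p.coeff k) * rootPoly a S) = 0 := by
    refine eq_zero_of_eval_eq_zero_of_natDegree_lt ha (S := S.erase i) (fun j hj => ?_) ?_
    · rw [eval_sub, eval_mul, hv j hj,
        (eval_rootPoly_eq_zero_iff ha).mpr (Finset.mem_of_mem_erase hj), mul_zero, sub_zero]
    · rw [Finset.card_erase_of_mem hi, hS]
      refine lt_of_le_of_lt ((natDegree_le_iff_coeff_eq_zero (n := k - 2)).mpr fun m hm => ?_)
        (by omega)
      rw [coeff_sub, coeff_C_mul]
      rcases lt_trichotomy m k with h | rfl | h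
      · obtain rfl : m = k - 1 := by omega
        have := coeff_rootPoly_card_sub_one (a := a) (S := S) (by omega) h0
        rw [hS] at this
        rw [hp', this, mul_zero, sub_zero]
      · have := coeff_rootPoly_card a S
        rw [hS] at this
        rw [this, mul_one, sub_self]
      · rw [coeff_eq_zero_of_natDegree_lt (hp.trans_lt h), coeff_eq_zero_of_natDegree_lt
          (p := rootPoly a S) (by rw [natDegree_rootPoly, hS]; exact h), mul_zero, sub_zero]
  rw [sub_eq_zero.mp hr, eval_mul, (eval_rootPoly_eq_zero_iff ha).mpr hi, mul_zero]

theorem hammingDist_eq_sub_card {A : Type*} [DecidableEq A] (x y : Fin n → A) :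
    hammingDist x y = n - (Finset.univ.filter fun j => x j = y j).card := by
  have := Finset.card_filter_add_card_filter_not (s := (Finset.univ : Finset (Fin n)))
    (fun j => x j = y j)
  rw [Finset.card_univ, Fintype.card_fin] at this
  unfold hammingDist
  simp only [ne_eq]
  omega

theorem isLRC_skipCode [DecidableEq F] {a v : Fin n → F} {k : ℕ} (ha : Function.Injective a)
    (hv : ∀ j, v j ≠ 0) (hk : 2 ≤ k) (hkn : k < n)
    (hS : ∀ i, ∃ S : Finset (Fin n), i ∈ S ∧ S.card = k ∧ ∑ j ∈ S, a j = 0) :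
    IsLRC (skipCode a v k) k (n - k) (k - 1) := by
  have hk1 : 1 ≤ k := by omega
  refine ⟨⟨finrank_skipCode ha hv hkn, ?_, ?_⟩, fun i => ?_, fun i R hR => ?_⟩
  · obtain ⟨S, -, hSk, h0⟩ := hS ⟨0, by omega⟩
    have hz : ∀ j, v j * (rootPoly a S).eval (a j) = 0 ↔ j ∈ S := fun j => by
      rw [mul_eq_zero, or_iff_right (hv j), eval_rootPoly_eq_zero_iff ha]
    have hd : hammingDist (fun j => v j * (rootPoly a S).eval (a j)) 0 = n - k := by
      rw [hammingDist_eq_sub_card]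
      simp only [Pi.zero_apply, hz, Finset.filter_univ_mem, hSk]
    refine ⟨_, (mem_skipCode hk1).mpr ⟨rootPoly a S, ?_, ?_, fun _ => rfl⟩, 0,
      Submodule.zero_mem _, ?_, hd⟩
    · rw [natDegree_rootPoly, hSk]
    · rw [← hSk]; exact coeff_rootPoly_card_sub_one (by omega) h0
    · rw [← hammingDist_pos, hd]; omega
  · rintro w ⟨x, hx, y, hy, hxy, rfl⟩
    obtain ⟨p, hp, -, hpc⟩ := (mem_skipCode hk1).mp (Submodule.sub_mem _ hx hy)
    rw [hammingDist_eq_sub_card]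
    refine Nat.sub_le_sub_left ?_ n
    by_contra! hlt
    have hp0 : p = 0 := by
      refine eq_zero_of_eval_eq_zero_of_natDegree_lt ha (fun j hj => ?_) (hp.trans_lt hlt)
      have h1 := hpc j
      rw [Pi.sub_apply, (Finset.mem_filter.mp hj).2, sub_self] at h1
      exact (mul_eq_zero.mp h1.symm).resolve_left (hv j)
    refine hxy (sub_eq_zero.mp (funext fun j => ?_))
    rw [hpc, hp0, eval_zero, mul_zero, Pi.zero_apply]
  · obtain ⟨S, hi, hSk, h0⟩ := hS i
    refine ⟨S.erase i, by rw [Finset.card_erase_of_mem hi, hSk], ?_⟩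
    rw [isRecoveringSet_iff]
    refine ⟨Finset.notMem_erase _ _, fun c hc hz => ?_⟩
    obtain ⟨p, hp, hp', hpc⟩ := (mem_skipCode hk1).mp hc
    rw [hpc, eval_eq_zero_of_sum_eq_zero ha hk hp hp' hSk h0 hi, mul_zero]
    intro j hj
    have h1 := hz j hj
    rw [hpc] at h1
    exact (mul_eq_zero.mp h1).resolve_left (hv j)
  · rw [isRecoveringSet_iff] at hR
    by_contra! hlt
    have hmem : (fun j => v j * (rootPoly a R).eval (a j)) ∈ skipCode a v k := by
      refine (mem_skipCode hk1).mpr ⟨rootPoly a R, ?_, ?_, fun _ => rfl⟩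
      · rw [natDegree_rootPoly]; omega
      · exact coeff_eq_zero_of_natDegree_lt (by rwa [natDegree_rootPoly])
    have := hR.2 _ hmem fun j hj => by rw [(eval_rootPoly_eq_zero_iff ha).mpr hj, mul_zero]
    exact hR.1 ((eval_rootPoly_eq_zero_iff ha).mp ((mul_eq_zero.mp this).resolve_left (hv i)))

theorem kOpt_self [DecidableEq F] {m : ℕ} (hm : 1 ≤ m) : kOpt F m m = 1 := by
  refine (isGreatest_kOpt F m m).unique ⟨?_, ?_⟩
  · have h1 : (1 : Fin m → F) ≠ 0 := fun h => one_ne_zero (congrFun h ⟨0, hm⟩)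
    refine ⟨Submodule.span F {1}, finrank_span_singleton h1, fun x hx y hy hxy => ?_⟩
    obtain ⟨s, rfl⟩ := Submodule.mem_span_singleton.mp hx
    obtain ⟨t, rfl⟩ := Submodule.mem_span_singleton.mp hy
    have hst : s ≠ t := fun h => hxy (by rw [h])
    rw [hammingDist_eq_sub_card, Finset.filter_false_of_mem]
    · simp
    · intro j _
      simpa using hst
  · rintro d ⟨D, rfl, hD⟩
    let φ : D →ₗ[F] F := (LinearMap.proj ⟨0, hm⟩).comp D.subtype
    have hφ : Function.Injective φ := by
      intro x y hxy
      by_contra hne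
      have h1 := hD x x.2 y y.2 fun h => hne (Subtype.ext h)
      rw [hammingDist_eq_sub_card] at h1
      have h2 : 0 < (Finset.univ.filter fun j => (x : Fin m → F) j = (y : Fin m → F) j).card :=
        Finset.card_pos.mpr ⟨⟨0, hm⟩, Finset.mem_filter.mpr ⟨Finset.mem_univ _, hxy⟩⟩
      omega
    simpa using LinearMap.finrank_le_finrank_of_injective hφ

theorem IsLRC.isKOptimal [DecidableEq F] {C : Submodule F (Fin n → F)} {k : ℕ} (hk : 2 ≤ k)
    (hkn : k < n) (h : IsLRC C k (n - k) (k - 1)) : IsKOptimal C k (n - k) (k - 1) := by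
  refine ⟨h, ⟨1, le_rfl, ?_⟩, ?_⟩
  · rw [one_mul, Nat.sub_add_cancel (by omega), kOpt_self (by omega)]
    omega
  · rintro b ⟨t, ht, rfl⟩
    rcases ht.eq_or_lt with rfl | h2
    · rw [one_mul, Nat.sub_add_cancel (by omega), kOpt_self (by omega)]
      omega
    · have := Nat.mul_le_mul_left (k - 1) h2
      omega

theorem IsLRC.isDOptimal [DecidableEq F] {C : Submodule F (Fin n → F)} {k : ℕ} (hk : 3 ≤ k)
    (hkn : k ≤ n) (h : IsLRC C k (n - k) (k - 1)) : IsDOptimal C k (n - k) (k - 1) := by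
  refine ⟨h, ?_⟩
  have hk' : (3 : ℚ) ≤ k := by exact_mod_cast hk
  have hc : ⌈(k : ℚ) / ((k - 1 : ℕ) : ℚ)⌉ = 2 := by
    rw [Nat.cast_sub (by omega), Nat.cast_one, Int.ceil_eq_iff]
    constructor
    · rw [lt_div_iff₀ (by linarith)]
      norm_num
    · rw [div_le_iff₀ (by linarith)]
      norm_num
      linarith
  rw [hc, Nat.cast_sub hkn]
  ring

section ZeroSum

variable [Fintype F] [DecidableEq F]

theorem exists_zero_sum_of_two_mul_lt {k : ℕ} (h2 : (2 : F) = 0) (hk : 3 ≤ k)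
    (hk2 : 2 * (k - 1) < Fintype.card F) :
    ∃ S : Finset F, 0 ∉ S ∧ S.card = k ∧ ∑ x ∈ S, x = 0 := by
  obtain ⟨T, hT0, hTk, hTs⟩ : ∃ T : Finset F, 0 ∉ T ∧ T.card = k - 2 ∧ ∑ x ∈ T, x ≠ 0 := by
    obtain ⟨U, hU, hUk⟩ := Finset.exists_subset_card_eq
      (s := (Finset.univ : Finset F).erase 0) (n := k - 1)
      (by rw [Finset.card_erase_of_mem (Finset.mem_univ _), Finset.card_univ]; omega)
    have hU0 : (0 : F) ∉ U := fun h => Finset.notMem_erase _ _ (hU h)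
    obtain ⟨a, ha, b, hb, hab⟩ := Finset.one_lt_card.mp (show 1 < U.card by omega)
    by_cases h : ∑ x ∈ U.erase a, x = 0
    · refine ⟨U.erase b, fun h0 => hU0 (Finset.mem_of_mem_erase h0),
        by rw [Finset.card_erase_of_mem hb]; omega, fun h' => hab ?_⟩
      have h1 := Finset.add_sum_erase U (fun x => x) ha
      have h3 := Finset.add_sum_erase U (fun x => x) hb
      simp only [h, h', add_zero] at h1 h3
      rw [h1, h3]
    · exact ⟨U.erase a, fun h0 => hU0 (Finset.mem_of_mem_erase h0),
        by rw [Finset.card_erase_of_mem ha]; omega, h⟩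
  have hcard : (insert 0 T).card = k - 1 := by
    rw [Finset.card_insert_of_notMem hT0]; omega
  set s := ∑ x ∈ T, x with hs
  obtain ⟨x, -, hx⟩ := Finset.exists_mem_notMem_of_card_lt_card
    (s := insert 0 T ∪ (insert 0 T).image fun x => s - x) (t := Finset.univ) <| by
      refine (Finset.card_union_le _ _).trans_lt ?_
      have := Finset.card_image_le (s := insert 0 T) (f := fun x => s - x)
      rw [Finset.card_univ]
      omega
  rw [Finset.mem_union, not_or] at hx
  have hx1 := hx.1
  have hy1 : s - x ∉ insert 0 T := fun h =>
    hx.2 (Finset.mem_image.mpr ⟨s - x, h, sub_sub_cancel _ _⟩)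
  rw [Finset.mem_insert, not_or] at hx1 hy1
  have hxy : x ≠ s - x := fun h => hTs <| by
    rw [eq_sub_iff_add_eq.mp h |>.symm, ← two_mul, h2, zero_mul]
  have hx3 : x ∉ insert (s - x) T := by
    rw [Finset.mem_insert, not_or]; exact ⟨hxy, hx1.2⟩
  refine ⟨insert x (insert (s - x) T), ?_, ?_, ?_⟩
  · simp only [Finset.mem_insert, not_or]
    exact ⟨fun h => hx1.1 h.symm, fun h => hy1.1 h.symm, hT0⟩
  · rw [Finset.card_insert_of_notMem hx3, Finset.card_insert_of_notMem hy1.2]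
    omega
  · rw [Finset.sum_insert hx3, Finset.sum_insert hy1.2, ← hs, ← add_assoc, add_sub_cancel,
      ← two_mul, h2, zero_mul]

theorem exists_zero_sum {k : ℕ} (h2 : (2 : F) = 0) (hk : 3 ≤ k) (hk4 : k + 4 ≤ Fintype.card F) :
    ∃ S : Finset F, 0 ∉ S ∧ S.card = k ∧ ∑ x ∈ S, x = 0 := by
  by_cases hlt : 2 * (k - 1) < Fintype.card F
  · exact exists_zero_sum_of_two_mul_lt h2 hk hlt
  · obtain ⟨S, h0, hS, hs⟩ := exists_zero_sum_of_two_mul_lt (F := F) (k := Fintype.card F - 1 - k)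
      h2 (by omega) (by omega)
    refine ⟨(insert 0 S)ᶜ, by simp, ?_, ?_⟩
    · rw [Finset.card_compl, Finset.card_insert_of_notMem h0]
      omega
    · have h1 := Finset.sum_add_sum_compl (insert 0 S) fun x => x
      have h3 := FiniteField.sum_pow_lt_card_sub_one F 1 (by omega)
      simp only [pow_one] at h3
      rwa [Finset.sum_insert h0, hs, h3, add_zero, zero_add] at h1

theorem exists_zero_sum_mem {k : ℕ} (h2 : (2 : F) = 0) (hk : 3 ≤ k)
    (hk4 : k + 4 ≤ Fintype.card F) {x : F} (hx : x ≠ 0) :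
    ∃ S : Finset F, 0 ∉ S ∧ x ∈ S ∧ S.card = k ∧ ∑ y ∈ S, y = 0 := by
  obtain ⟨S, h0, hS, hs⟩ := exists_zero_sum h2 hk hk4
  obtain ⟨s, hsS⟩ := Finset.card_pos.mp (show 0 < S.card by omega)
  have hs0 : s ≠ 0 := fun h => h0 (h ▸ hsS)
  have hinj : Function.Injective fun y : F => x / s * y :=
    mul_right_injective₀ (div_ne_zero hx hs0)
  refine ⟨S.image fun y => x / s * y, ?_, ?_, ?_, ?_⟩
  · intro h
    obtain ⟨y, hy, hy0⟩ := Finset.mem_image.mp h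
    rw [(mul_eq_zero.mp hy0).resolve_left (div_ne_zero hx hs0)] at hy
    exact h0 hy
  · exact Finset.mem_image.mpr ⟨s, hsS, div_mul_cancel₀ x hs0⟩
  · rw [Finset.card_image_of_injective _ hinj, hS]
  · rw [Finset.sum_image hinj.injOn, ← Finset.mul_sum, hs, mul_zero]

end ZeroSum

theorem mem_dualCode_span {s : Set (Fin n → F)} {y : Fin n → F} :
    y ∈ dualCode (Submodule.span F s) ↔ ∀ x ∈ s, ∑ i, x i * y i = 0 := by
  refine ⟨fun h x hx => h x (Submodule.subset_span hx), fun h x hx => ?_⟩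
  induction hx using Submodule.span_induction with
  | mem x hx => exact h x hx
  | zero => simp
  | add u w _ _ hu hw =>
    simp only [Pi.add_apply, add_mul, Finset.sum_add_distrib]
    rw [hu, hw, add_zero]
  | smul c u _ hu =>
    simp only [Pi.smul_apply, smul_eq_mul, mul_assoc]
    rw [← Finset.mul_sum, hu, mul_zero]

theorem finrank_add_finrank_dualCode_span_row {k : ℕ} (M : Matrix (Fin k) (Fin n) F) :
    Module.finrank F (Submodule.span F (Set.range M.row)) +
      Module.finrank F (dualCode (Submodule.span F (Set.range M.row))) = n := by
  have hker : dualCode (Submodule.span F (Set.range M.row)) = LinearMap.ker M.mulVecLin := by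
    ext y
    rw [mem_dualCode_span, LinearMap.mem_ker, Set.forall_mem_range]
    exact funext_iff.symm
  rw [hker, ← Matrix.rank_eq_finrank_span_row, Matrix.rank, LinearMap.finrank_range_add_finrank_ker,
    Module.finrank_fin_fun]

theorem sum_pow_succ_pow_eq_zero {α : F} (hα : IsPrimitiveRoot α n) {s : ℕ} (hs : ¬ n ∣ s) :
    ∑ j : Fin n, (α ^ ((j : ℕ) + 1)) ^ s = 0 := by
  have hne : α ^ s ≠ 1 := fun h => hs ((hα.pow_eq_one_iff_dvd s).mp h)
  have h1 := geom_sum_mul (α ^ s) n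
  rw [← pow_mul, mul_comm s n, pow_mul, hα.pow_eq_one, one_pow, sub_self] at h1
  have h2 := (mul_eq_zero.mp h1).resolve_right (sub_ne_zero.mpr hne)
  rw [Fin.sum_univ_eq_sum_range fun j => (α ^ (j + 1)) ^ s]
  rw [← mul_zero (α ^ s), ← h2, Finset.mul_sum]
  exact Finset.sum_congr rfl fun j _ => by ring

theorem codeC_eq_skipCode (α : F) (q k : ℕ) :
    codeC α q k = skipCode (fun j : Fin (q - 1) => α ^ ((j : ℕ) + 1)) 1 k := by
  unfold codeC skipCode
  congr 2
  funext i j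
  simp [genMatrix, skipExponent, Matrix.row]

theorem injective_pow_succ {α : F} (hα : IsPrimitiveRoot α n) :
    Function.Injective fun j : Fin n => α ^ ((j : ℕ) + 1) := by
  intro i j hij
  rcases Nat.eq_zero_or_pos n with rfl | hn
  · exact i.elim0
  · have h0 : α ≠ 0 := hα.ne_zero hn.ne'
    simp only [pow_succ] at hij
    exact Fin.ext (hα.pow_inj i.2 j.2 (mul_right_cancel₀ h0 hij))

theorem dualCode_codeC {α : F} {q k : ℕ} (hα : IsPrimitiveRoot α (q - 1)) (hk : 2 ≤ k)
    (hkq : k + 3 ≤ q) :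
    dualCode (codeC α q k) =
      skipCode (fun j : Fin (q - 1) => α ^ ((j : ℕ) + 1)) (fun j => α ^ ((j : ℕ) + 1))
        (q - 1 - k) := by
  have hα0 : α ≠ 0 := hα.ne_zero (by omega)
  have hinj := injective_pow_succ hα
  symm
  apply Submodule.eq_of_le_of_finrank_eq
  · refine Submodule.span_le.mpr ?_
    rintro _ ⟨i, rfl⟩
    rw [codeC_eq_skipCode, SetLike.mem_coe, skipCode, mem_dualCode_span]
    rintro _ ⟨l, rfl⟩
    have hs : ¬ q - 1 ∣ skipExponent k l + (skipExponent (q - 1 - k) i + 1) := by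
      have := l.2
      have := i.2
      rintro ⟨c, hc⟩
      have hc2 : c < 2 := by
        by_contra! h
        have := Nat.mul_le_mul_left (q - 1) h
        unfold skipExponent at hc
        split_ifs at hc <;> omega
      interval_cases c <;> unfold skipExponent at hc <;> split_ifs at hc <;> omega
    rw [← sum_pow_succ_pow_eq_zero hα hs]
    exact Finset.sum_congr rfl fun j _ => by
      simp only [Pi.one_apply, one_mul, pow_add, pow_one]
      ring
  · rw [finrank_skipCode hinj (fun j => pow_ne_zero _ hα0) (by omega)]
    have h1 := finrank_add_finrank_dualCode_span_row (genMatrix α q k)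
    have h2 : Module.finrank F (codeC α q k) = k := by
      rw [codeC_eq_skipCode]
      exact finrank_skipCode hinj (fun j => one_ne_zero) (by omega)
    change Module.finrank F (codeC α q k) + Module.finrank F (dualCode (codeC α q k)) = _ at h1
    omega

theorem exists_finset_sum_pow_succ_eq_zero [Fintype F] [DecidableEq F] {α : F} {q k : ℕ}
    (hF : Fintype.card F = q) (hα : IsPrimitiveRoot α (q - 1)) (h2 : (2 : F) = 0) (hk : 3 ≤ k)
    (hk4 : k + 4 ≤ q) (i : Fin (q - 1)) :
    ∃ S : Finset (Fin (q - 1)), i ∈ S ∧ S.card = k ∧ ∑ j ∈ S, α ^ ((j : ℕ) + 1) = 0 := by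
  have hα0 : α ≠ 0 := hα.ne_zero (by omega)
  have hinj := injective_pow_succ hα
  set a : Fin (q - 1) → F := fun j => α ^ ((j : ℕ) + 1) with ha
  have himage : Finset.univ.image a = Finset.univ.erase 0 := by
    refine Finset.eq_of_subset_of_card_le (fun x hx => ?_) ?_
    · obtain ⟨j, -, rfl⟩ := Finset.mem_image.mp hx
      exact Finset.mem_erase.mpr ⟨pow_ne_zero _ hα0, Finset.mem_univ _⟩
    · rw [Finset.card_image_of_injective _ hinj, Finset.card_erase_of_mem (Finset.mem_univ _),
        Finset.card_univ, Finset.card_univ, Fintype.card_fin, hF]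
  obtain ⟨S, h0, hiS, hS, hs⟩ := exists_zero_sum_mem h2 hk (hF ▸ hk4)
    (pow_ne_zero ((i : ℕ) + 1) hα0)
  obtain ⟨T, -, rfl⟩ := Finset.subset_image_iff.mp
    (show S ⊆ Finset.univ.image a from himage ▸ fun x hx =>
      Finset.mem_erase.mpr ⟨fun h => h0 (h ▸ hx), Finset.mem_univ _⟩)
  refine ⟨T, ?_, ?_, ?_⟩
  · obtain ⟨j, hj, hji⟩ := Finset.mem_image.mp hiS
    exact hinj hji ▸ hj
  · rwa [Finset.card_image_of_injective _ hinj] at hS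
  · rwa [Finset.sum_image hinj.injOn] at hs

end LRC

theorem mainTheorem4 (h q k : ℕ) (hh : 3 ≤ h) (hq : q = 2 ^ h) (hk3 : 3 ≤ k) (hk4 : k + 4 ≤ q)
    {F : Type*} [Field F] [Fintype F] [DecidableEq F] (hF : Fintype.card F = q)
    (α : F) (hα : IsPrimitiveRoot α (q - 1)) :
    (LRC.IsLRC (LRC.codeC α q k) k (q - k - 1) (k - 1) ∧
      LRC.IsKOptimal (LRC.codeC α q k) k (q - k - 1) (k - 1) ∧
      LRC.IsDOptimal (LRC.codeC α q k) k (q - k - 1) (k - 1)) ∧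
    (LRC.IsLRC (LRC.dualCode (LRC.codeC α q k)) (q - k - 1) k (q - k - 2) ∧
      LRC.IsKOptimal (LRC.dualCode (LRC.codeC α q k)) (q - k - 1) k (q - k - 2) ∧
      LRC.IsDOptimal (LRC.dualCode (LRC.codeC α q k)) (q - k - 1) k (q - k - 2)) := by
  have h2 : (2 : F) = 0 := by
    have h1 := Nat.cast_card_eq_zero F
    rw [hF, hq, Nat.cast_pow, Nat.cast_ofNat] at h1
    exact pow_eq_zero_iff (by omega) |>.mp h1
  have hα0 : α ≠ 0 := hα.ne_zero (by omega)
  have hinj := LRC.injective_pow_succ hα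
  have e1 : q - k - 1 = q - 1 - k := by omega
  have e2 : q - k - 2 = q - 1 - k - 1 := by omega
  have e3 : q - 1 - (q - 1 - k) = k := by omega
  have hC : LRC.IsLRC (LRC.codeC α q k) k (q - 1 - k) (k - 1) := by
    rw [LRC.codeC_eq_skipCode]
    exact LRC.isLRC_skipCode hinj (fun _ => one_ne_zero) (by omega) (by omega)
      (LRC.exists_finset_sum_pow_succ_eq_zero hF hα h2 hk3 hk4)
  have hD : LRC.IsLRC (LRC.dualCode (LRC.codeC α q k)) (q - 1 - k) (q - 1 - (q - 1 - k))
      (q - 1 - k - 1) := by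
    rw [LRC.dualCode_codeC hα (by omega) (by omega)]
    exact LRC.isLRC_skipCode hinj (fun _ => pow_ne_zero _ hα0) (by omega) (by omega)
      (LRC.exists_finset_sum_pow_succ_eq_zero hF hα h2 (by omega) (by omega))
  have hDk := hD.isKOptimal (by omega) (by omega)
  have hDd := hD.isDOptimal (by omega) (by omega)
  rw [e3] at hD hDk hDd
  rw [e1, e2]
  exact ⟨⟨hC, hC.isKOptimal (by omega) (by omega), hC.isDOptimal (by omega) (by omega)⟩,
    hD, hDk, hDd⟩
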